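/- Let $G=(V,E)$ be a finite simple graph, $d\ge 1$ and $p:V\to\mathbb{R}^d$. For $u,v\in V$ let $d_{uv}=\frac{p(u)-p(v)}{\|p(u)-p(v)\|}$ if $p(u)\neq p(v)$ and $d_{uv}=0$ otherwise, where $\|\cdot\|$ is the Euclidean norm. Let $R(G,p)\in\mathbb{R}^{d|V|\times|E|}$ be the matrix with rows indexed by pairs $(u,i)\in V\times\{1,\dots,d\}$ and columns indexed by edges, whose $((u,i),e)$ entry is $(d_{uv})_i$ if $e=\{u,v\}$ for some $v\in V$, and $0$ otherwise. Let $L(G,p)=R(G,p)R(G,p)^{T}$ be the stiffness matrix, let $\lambda_k(L(G,p))$ be its $k$-th smallest eigenvalue (counted with multiplicity), and define the $d$-dimensional algebraic connectivity of $G$ by $$a_d(G)=\sup\left\{\lambda_{\binom{d+1}{2}+1}(L(G,p))\;:\;p:V\to\mathbb{R}^d\right\}.$$ Let $K_{n,m}$ be the complete bipartite graph with sides of size $n$ and $m$. **Theorem 1.4.** Let $d\ge 1$. Then there exists a constant $c_d>0$ (depending only on $d$) such that, for all integers $n,m\ge d+1$ with $n+m\ge\binom{d+2}{2}$, $$a_d(K_{n,m})\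 \ge\ c_d\cdot\min\{n,m\}.$$ -/

import Mathlib

/-- The `k`-th smallest eigenvalue (`1 ≤ k ≤ N`, counted with multiplicity) of a real symmetric
`N × N` matrix. Mathlib's `eigenvalues₀` lists the eigenvalues in non-increasing order, starting
at index `0`. The value for `k` out of range is a dummy. -/
noncomputable def kthSmallestEigenvalue {ι : Type*} [Fintype ι] [DecidableEq ι]
    {A : Matrix ι ι ℝ} (hA : A.IsHermitian) (k : ℕ) : ℝ :=
  if h : 1 ≤ k ∧ k ≤ Fintype.card ι then
    hA.eigenvalues₀ ⟨Fintype.card ι - k, by omega⟩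
  else 0

namespace SimpleGraph

variable {V : Type*} {d : ℕ}

open Classical in
/-- The unit vector `d_{uv} = (p u - p v) / ‖p u - p v‖`, or `0` if `p u = p v`
(Euclidean norm). -/
noncomputable def edgeDirection (p : V → EuclideanSpace ℝ (Fin d)) (u v : V) :
    EuclideanSpace ℝ (Fin d) :=
  if p u = p v then 0 else ‖p u - p v‖⁻¹ • (p u - p v)

open Classical in
/-- The normalized rigidity matrix `R(G, p)`: rows are indexed by pairs `(u, i)` of a vertex and a
coordinate, columns by the edges; the entry at `((u, i), e)` is `(d_{uv})_i` if `e = {u, v}` for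
some vertex `v` (this is the other endpoint of `e`), and `0` if `u` is not an endpoint of `e`. -/
noncomputable def rigidityMatrix (G : SimpleGraph V) (p : V → EuclideanSpace ℝ (Fin d)) :
    Matrix (V × Fin d) G.edgeSet ℝ :=
  Matrix.of fun x e =>
    if h : x.1 ∈ (e : Sym2 V) then edgeDirection p x.1 (Sym2.Mem.other h) x.2 else 0

open Classical in
/-- The stiffness matrix `L(G, p) = R(G, p) R(G, p)ᵀ`. -/
noncomputable def stiffnessMatrix [Fintype V] (G : SimpleGraph V)
    (p : V → EuclideanSpace ℝ (Fin d)) : Matrix (V × Fin d) (V × Fin d) ℝ :=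
  G.rigidityMatrix p * (G.rigidityMatrix p).transpose

theorem isHermitian_stiffnessMatrix [Fintype V] (G : SimpleGraph V)
    (p : V → EuclideanSpace ℝ (Fin d)) : (G.stiffnessMatrix p).IsHermitian := by
  simp [stiffnessMatrix, Matrix.IsHermitian, Matrix.conjTranspose_eq_transpose_of_trivial,
    Matrix.transpose_mul]

open Classical in
/-- The spectral gap of the `d`-dimensional framework `(G, p)`: the `(binom (d+1) 2 + 1)`-th
smallest eigenvalue of its stiffness matrix. -/
noncomputable def spectralGap [Fintype V] (G : SimpleGraph V)
    (p : V → EuclideanSpace ℝ (Fin d)) : ℝ :=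
  kthSmallestEigenvalue (G.isHermitian_stiffnessMatrix p) ((d + 1).choose 2 + 1)

/-- The `d`-dimensional algebraic connectivity `a_d(G)`: the supremum of the spectral gaps of
`(G, p)` over all maps `p : V → ℝ^d`. -/
noncomputable def algebraicConnectivity [Fintype V] (d : ℕ) (G : SimpleGraph V) : ℝ :=
  sSup (Set.range fun p : V → EuclideanSpace ℝ (Fin d) => G.spectralGap p)

end SimpleGraph

/-! Blow up a small rigid framework. Fix `s`, `t` at least `d + 1` with `s + t ≥ (d + 2).choose 2`,
and put the vertices of `K_{s,t}` on a monomial curve. By a Bolker–Roth argument its infinitesimal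
motions come from skew-symmetric matrices, so they form a space of dimension at most `(d + 1).choose
2` (`finrank_ker_bipartiteStretch_le`). For `n ≥ s` and `m ≥ t`, replace each vertex by a cluster of
coincident vertices, of size at least `n / (2s)` or `m / (2t)`. The energy of a displacement is
bounded below by that of the cluster averages in the small framework plus that of the deviations
from them (`le_sum_sum_sq_of_cluster`). Deviations are controlled because each vertex sees the other
side in directions spanning `ℝ^d`; averages are controlled after imposing at most `(d + 1).choose 2`
linear conditions. Both bounds are of order `min n m`, and Courant–Fischer
(`le_kthSmallestEigenvalue`) turns them into an eigenvalue bound. Truncating `n` and `m` at `(d +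
2).choose 2` leaves finitely many pairs `(s, t)`, so one constant serves all. -/

/-! ### Eigenvalue bounds -/

open Matrix in
theorem le_kthSmallestEigenvalue {ι W : Type*} [Fintype ι] [DecidableEq ι] [AddCommGroup W]
    [Module ℝ W] [FiniteDimensional ℝ W] {A : Matrix ι ι ℝ} (hA : A.IsHermitian)
    (Φ : (ι → ℝ) →ₗ[ℝ] W) {k : ℕ} (hk : Module.finrank ℝ W ≤ k) (hcard : k + 1 ≤ Fintype.card ι)
    {μ : ℝ} (h : ∀ x, Φ x = 0 → μ * (x ⬝ᵥ x) ≤ x ⬝ᵥ (A *ᵥ x)) :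
    μ ≤ kthSmallestEigenvalue hA (k + 1) := by
  rw [kthSmallestEigenvalue, dif_pos ⟨by omega, hcard⟩]
  set N := Fintype.card ι with hN
  let e : Fin N ≃ ι := Fintype.equivOfCardEq (Fintype.card_fin _)
  -- `eigenvalues₀` is non-increasing, so the last `k + 1` indices carry the smallest eigenvalues.
  -- The span of their eigenvectors is too large for `Φ` to be injective on it, and the Rayleigh
  -- quotient there is at most the `(k + 1)`-th smallest eigenvalue.
  let r : Fin (k + 1) → Fin N := fun l => ⟨N - (k + 1) + l, by omega⟩
  have hr : Function.Injective r := fun l l' hl => by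
    simp only [r, Fin.mk.injEq] at hl
    exact Fin.ext (by omega)
  let V : Fin (k + 1) → ι → ℝ := fun l => (hA.eigenvectorBasis (e (r l))).ofLp
  have hV : ∀ l l', V l ⬝ᵥ V l' = if l = l' then 1 else 0 := by
    intro l l'
    have := (orthonormal_iff_ite.1 hA.eigenvectorBasis.orthonormal) (e (r l')) (e (r l))
    rw [EuclideanSpace.inner_eq_star_dotProduct] at this
    simp only [star_trivial, EmbeddingLike.apply_eq_iff_eq, hr.eq_iff] at this
    simpa [eq_comm] using this
  have hAV : ∀ l, A *ᵥ V l = hA.eigenvalues₀ (r l) • V l := by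
    intro l
    have := hA.mulVec_eigenvectorBasis (e (r l))
    have h2 : hA.eigenvalues (e (r l)) = hA.eigenvalues₀ (r l) := by
      simp [IsHermitian.eigenvalues, e]
    rw [h2] at this
    simpa using this
  let S : (Fin (k + 1) → ℝ) →ₗ[ℝ] (ι → ℝ) := Fintype.linearCombination ℝ V
  have hker : LinearMap.ker (Φ ∘ₗ S) ≠ ⊥ :=
    LinearMap.ker_ne_bot_of_finrank_lt (by simpa using Nat.lt_succ_of_le hk)
  obtain ⟨c, hc, hc0⟩ := Submodule.exists_mem_ne_zero_of_ne_bot hker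
  have hS : S c = ∑ l, c l • V l := Fintype.linearCombination_apply ℝ V c
  have h1 := h (S c) (by simpa using hc)
  have hxx : S c ⬝ᵥ S c = ∑ l, c l ^ 2 := by
    simp [hS, sum_dotProduct, dotProduct_sum, hV, pow_two]
  have hxAx : S c ⬝ᵥ (A *ᵥ S c) = ∑ l, hA.eigenvalues₀ (r l) * c l ^ 2 := by
    rw [hS, mulVec_sum]
    simp only [mulVec_smul, hAV]
    simp only [sum_dotProduct, dotProduct_sum, smul_dotProduct, dotProduct_smul, hV, smul_eq_mul]
    simp
    exact Finset.sum_congr rfl fun l _ => by ring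
  have hle : ∑ l, hA.eigenvalues₀ (r l) * c l ^ 2 ≤
      hA.eigenvalues₀ ⟨N - (k + 1), by omega⟩ * ∑ l, c l ^ 2 := by
    rw [Finset.mul_sum]
    refine Finset.sum_le_sum fun l _ => mul_le_mul_of_nonneg_right ?_ (sq_nonneg _)
    exact hA.eigenvalues₀_antitone (Fin.mk_le_mk.2 (by omega))
  have hpos : 0 < ∑ l, c l ^ 2 := by
    obtain ⟨l, hl⟩ := Function.ne_iff.1 hc0
    exact Finset.sum_pos' (fun _ _ => sq_nonneg _) ⟨l, Finset.mem_univ _, sq_pos_of_ne_zero hl⟩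
  rw [hxx, hxAx] at h1
  exact le_of_mul_le_mul_right (h1.trans hle) hpos

theorem Matrix.PosSemidef.kthSmallestEigenvalue_le_trace {ι : Type*} [Fintype ι] [DecidableEq ι]
    {A : Matrix ι ι ℝ} (h : A.PosSemidef) (hA : A.IsHermitian) (k : ℕ) :
    kthSmallestEigenvalue hA k ≤ A.trace := by
  have hnn : ∀ i, 0 ≤ hA.eigenvalues i := h.eigenvalues_nonneg
  have htr : A.trace = ∑ i, hA.eigenvalues i := by simpa using hA.trace_eq_sum_eigenvalues
  rw [htr, kthSmallestEigenvalue]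
  split_ifs with hk
  · let e : Fin (Fintype.card ι) ≃ ι := Fintype.equivOfCardEq (Fintype.card_fin _)
    have : ∀ i, hA.eigenvalues₀ i = hA.eigenvalues (e i) := fun i => by
      simp [Matrix.IsHermitian.eigenvalues, e]
    rw [this]
    exact Finset.single_le_sum (fun i _ => hnn i) (Finset.mem_univ _)
  · exact Finset.sum_nonneg fun i _ => hnn i

/-! ### The stiffness matrix as a quadratic form -/

namespace SimpleGraph

variable {V : Type*} {d : ℕ}

theorem edgeDirection_neg (p : V → EuclideanSpace ℝ (Fin d)) (u v : V) :
    edgeDirection p v u = -edgeDirection p u v := by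
  unfold edgeDirection
  by_cases h : p u = p v
  · simp [h]
  · rw [if_neg h, if_neg (Ne.symm h), norm_sub_rev, ← smul_neg, neg_sub]

theorem norm_edgeDirection_le (p : V → EuclideanSpace ℝ (Fin d)) (u v : V) :
    ‖edgeDirection p u v‖ ≤ 1 := by
  unfold edgeDirection
  split_ifs with h
  · simp
  · rw [norm_smul, norm_inv, norm_norm, inv_mul_cancel₀ (norm_ne_zero_iff.2 (sub_ne_zero.2 h))]

theorem sq_rigidityMatrix_le (G : SimpleGraph V) (p : V → EuclideanSpace ℝ (Fin d))
    (x : V × Fin d) (e : G.edgeSet) : G.rigidityMatrix p x e ^ 2 ≤ 1 := by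
  rw [sq_le_one_iff_abs_le_one, rigidityMatrix, Matrix.of_apply]
  split_ifs with h
  · exact (PiLp.norm_apply_le (edgeDirection p x.1 _) x.2).trans (norm_edgeDirection_le p _ _)
  · simp

open Classical in
theorem spectralGap_le [Fintype V] (G : SimpleGraph V) (p : V → EuclideanSpace ℝ (Fin d)) :
    G.spectralGap p ≤ Fintype.card (V × Fin d) * Fintype.card G.edgeSet := by
  have hpsd : (G.stiffnessMatrix p).PosSemidef := by
    simpa [stiffnessMatrix, Matrix.conjTranspose_eq_transpose_of_trivial] using
      Matrix.posSemidef_self_mul_conjTranspose (G.rigidityMatrix p)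
  refine (hpsd.kthSmallestEigenvalue_le_trace _ _).trans ?_
  calc (G.stiffnessMatrix p).trace = ∑ x, ∑ e, G.rigidityMatrix p x e ^ 2 := by
        simp [stiffnessMatrix, Matrix.trace, Matrix.mul_apply, pow_two]
    _ ≤ ∑ _x : V × Fin d, ∑ _e : G.edgeSet, (1 : ℝ) :=
        Finset.sum_le_sum fun x _ => Finset.sum_le_sum fun e _ => sq_rigidityMatrix_le G p x e
    _ = _ := by simp

/-- The uniform trace bound is essential: a real `sSup` over an unbounded set would be the dummy
value `0`. -/
theorem spectralGap_le_algebraicConnectivity [Fintype V] (G : SimpleGraph V)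
    (p : V → EuclideanSpace ℝ (Fin d)) : G.spectralGap p ≤ G.algebraicConnectivity d := by
  classical
  refine le_csSup ⟨Fintype.card (V × Fin d) * Fintype.card G.edgeSet, ?_⟩ (Set.mem_range_self p)
  rintro _ ⟨q, rfl⟩
  exact G.spectralGap_le q

open Matrix in
open Classical in
theorem dotProduct_stiffnessMatrix_mulVec [Fintype V] (G : SimpleGraph V)
    (p : V → EuclideanSpace ℝ (Fin d)) (x : V × Fin d → ℝ) :
    x ⬝ᵥ (G.stiffnessMatrix p *ᵥ x) = ∑ e, (∑ y, x y * G.rigidityMatrix p y e) ^ 2 := by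
  rw [stiffnessMatrix, ← mulVec_mulVec, dotProduct_mulVec, mulVec_transpose, dotProduct]
  simp only [vecMul, dotProduct, pow_two]

theorem sum_mul_rigidityMatrix [Fintype V] (G : SimpleGraph V)
    (p : V → EuclideanSpace ℝ (Fin d)) (x : V × Fin d → ℝ) {u v : V} (h : G.Adj u v) :
    ∑ y, x y * G.rigidityMatrix p y ⟨s(u, v), h⟩ =
      ∑ i, edgeDirection p u v i * (x (u, i) - x (v, i)) := by
  classical
  have hR : ∀ w i, G.rigidityMatrix p (w, i) ⟨s(u, v), h⟩ =
      (if w = u then edgeDirection p u v i else 0) +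
      (if w = v then edgeDirection p v u i else 0) := by
    intro w i
    have hne := h.ne
    simp only [rigidityMatrix, Matrix.of_apply]
    by_cases hu : w = u
    · subst hu
      have hm : w ∈ s(w, v) := Sym2.mem_mk_left w v
      have ho : Sym2.Mem.other hm = v := Sym2.congr_right.1 (Sym2.other_spec hm)
      rw [dif_pos hm, ho]
      simp [hne]
    · by_cases hv : w = v
      · subst hv
        have hm : w ∈ s(u, w) := Sym2.mem_mk_right u w
        have ho : Sym2.Mem.other hm = u :=
          Sym2.congr_right.1 ((Sym2.other_spec hm).trans Sym2.eq_swap)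
        rw [dif_pos hm, ho]
        simp [hu]
      · simp [hu, hv]
  rw [Fintype.sum_prod_type, Finset.sum_comm]
  refine Finset.sum_congr rfl fun i _ => ?_
  simp only [hR, mul_add, Finset.sum_add_distrib, mul_ite, mul_zero, Finset.sum_ite_eq',
    Finset.mem_univ, if_true, edgeDirection_neg p u v, PiLp.neg_apply]
  ring

open Matrix in
theorem sum_le_dotProduct_stiffnessMatrix_mulVec {α β : Type*} [Fintype α] [Fintype β]
    (p : α ⊕ β → EuclideanSpace ℝ (Fin d)) (x : (α ⊕ β) × Fin d → ℝ) :
    ∑ u, ∑ v, (∑ i, edgeDirection p (.inl u) (.inr v) i * (x (.inl u, i) - x (.inr v, i))) ^ 2 ≤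
      x ⬝ᵥ ((completeBipartiteGraph α β).stiffnessMatrix p *ᵥ x) := by
  classical
  have hadj : ∀ u v, (completeBipartiteGraph α β).Adj (.inl u) (.inr v) := fun u v => by simp
  let f : α × β → (completeBipartiteGraph α β).edgeSet := fun q => ⟨s(.inl q.1, .inr q.2), hadj _ _⟩
  have hf : Function.Injective f := fun q q' h => by
    have h' : s(Sum.inl q.1, Sum.inr q.2) = s(Sum.inl q'.1, Sum.inr q'.2) := Subtype.ext_iff.1 h
    simpa [Prod.ext_iff] using h'
  rw [dotProduct_stiffnessMatrix_mulVec, ← Fintype.sum_prod_type']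
  simp only [← sum_mul_rigidityMatrix _ p x (hadj _ _)]
  refine le_of_eq_of_le ?_ (Finset.sum_le_sum_of_subset_of_nonneg (Finset.subset_univ (Finset.univ.map ⟨f, hf⟩))
    (f := fun e => (∑ y, x y * (completeBipartiteGraph α β).rigidityMatrix p y e) ^ 2)
    (fun _ _ _ => sq_nonneg _))
  rw [Finset.sum_map]
  rfl

end SimpleGraph

/-! ### Descartes' rule of signs for sparse polynomials -/

namespace Polynomial

/-- Erasing the leading term removes at least one term and at most one sign variation, and a
monomial has no variation. -/
theorem signVariations_lt_card_support {P : ℝ[X]} (hP : P ≠ 0) :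
    P.signVariations < P.support.card := by
  induction h : P.support.card using Nat.strong_induction_on generalizing P with
  | _ n ih =>
    by_cases he : P.eraseLead = 0
    · have hm : P = monomial P.natDegree P.leadingCoeff := by
        conv_lhs => rw [← P.eraseLead_add_monomial_natDegree_leadingCoeff, he, zero_add]
      rw [hm, signVariations_monomial, ← h]
      exact Nat.pos_of_ne_zero (by simpa using hP)
    · have hlt := eraseLead_support_card_lt hP
      have := ih _ (h ▸ hlt) he rfl
      have := P.signVariations_le_eraseLead_succ
      omega

/-- A real polynomial has fewer distinct positive roots than it has terms. -/
theorem eq_zero_of_card_support_le {P : ℝ[X]} {T : Finset ℝ} (hT : ∀ t ∈ T, 0 < t ∧ P.eval t = 0)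
    (h : P.support.card ≤ T.card) : P = 0 := by
  by_contra hP
  have h1 : T.card ≤ P.roots.countP (0 < ·) := by
    rw [Multiset.countP_eq_card_filter]
    refine Multiset.card_le_card (s := T.val) ?_
    rw [Multiset.le_iff_subset T.nodup]
    intro t ht
    simp [hT t ht, hP]
  have h2 := P.roots_countP_pos_le_signVariations
  have h3 := signVariations_lt_card_support hP
  omega

end Polynomial

/-- Exponents of a monomial curve: the sums `curveExponent i + curveExponent j` are distinct for
distinct unordered pairs. -/
def curveExponent (i : ℕ) : ℕ := 3 ^ i - 1

theorem curveExponent_zero : curveExponent 0 = 0 := rfl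

theorem le_of_three_pow_add_three_pow_eq {i j k l : ℕ} (hkl : k ≤ l)
    (h : 3 ^ i + 3 ^ j = 3 ^ k + 3 ^ l) : j ≤ l := by
  by_contra hlt
  have h1 : 3 ^ (l + 1) ≤ 3 ^ j := Nat.pow_le_pow_right (by norm_num) (by omega)
  have h2 : 3 ^ k ≤ 3 ^ l := Nat.pow_le_pow_right (by norm_num) hkl
  have h3 : 0 < 3 ^ i := by positivity
  have h4 : 0 < 3 ^ l := by positivity
  rw [pow_succ] at h1
  omega

theorem three_pow_add_three_pow_inj {i j k l : ℕ} (hij : i ≤ j) (hkl : k ≤ l)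
    (h : 3 ^ i + 3 ^ j = 3 ^ k + 3 ^ l) : i = k ∧ j = l := by
  have hjl : j = l := le_antisymm (le_of_three_pow_add_three_pow_eq hkl h)
    (le_of_three_pow_add_three_pow_eq hij h.symm)
  subst hjl
  exact ⟨Nat.pow_right_injective (by norm_num : 2 ≤ 3) (by simpa using h), rfl⟩

theorem curveExponent_add_inj {i j k l : ℕ}
    (h : curveExponent i + curveExponent j = curveExponent k + curveExponent l) :
    s(i, j) = s(k, l) := by
  have hp : ∀ n, 1 ≤ 3 ^ n := fun n => Nat.one_le_pow _ _ (by norm_num)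
  have h' : 3 ^ i + 3 ^ j = 3 ^ k + 3 ^ l := by
    have := hp i; have := hp j; have := hp k; have := hp l
    simp only [curveExponent] at h
    omega
  rw [Sym2.eq_iff]
  rcases le_total i j with hij | hij <;> rcases le_total k l with hkl | hkl
  · have := three_pow_add_three_pow_inj hij hkl h'; omega
  · have := three_pow_add_three_pow_inj hij hkl (by omega); omega
  · have := three_pow_add_three_pow_inj hij hkl (by omega); omega
  · have := three_pow_add_three_pow_inj hij hkl (by omega); omega

theorem curveExponent_injective : Function.Injective curveExponent := fun i j h => by
  have := curveExponent_add_inj (i := i) (j := 0) (k := j) (l := 0) (by rw [h])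
  rw [Sym2.eq_iff] at this
  omega

/-! ### Linear and quadratic forms on the monomial curve -/

section MonomialCurve

open Matrix Polynomial

/-- Points of the monomial curve at the given parameters, in homogeneous coordinates. -/
noncomputable def curveMatrix {ι : Type*} (d : ℕ) (τ : ι → ℝ) : Matrix ι (Fin (d + 1)) ℝ :=
  Matrix.of fun i k => τ i ^ curveExponent k

theorem curveMatrix_zero {ι : Type*} (d : ℕ) (τ : ι → ℝ) (i : ι) : curveMatrix d τ i 0 = 1 := by
  simp [curveMatrix, curveExponent_zero]

/-- A linear form restricted to the curve is a polynomial with at most `d + 1` terms, too few for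
that many positive roots unless it vanishes. -/
theorem curveMatrix_mulVec_injective {ι : Type*} [Fintype ι] {d : ℕ} {τ : ι → ℝ}
    (hτ : Function.Injective τ) (hpos : ∀ i, 0 < τ i) (hcard : d + 1 ≤ Fintype.card ι)
    {c : Fin (d + 1) → ℝ} (h : curveMatrix d τ *ᵥ c = 0) : c = 0 := by
  let P : ℝ[X] := ∑ k : Fin (d + 1), monomial (curveExponent k) (c k)
  have hsupp : P.support.card ≤ Fintype.card ι := by
    have : P.support ⊆ Finset.univ.image fun k : Fin (d + 1) => curveExponent k := by
      intro e he
      by_contra hne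
      refine mem_support_iff.1 he ?_
      simp only [P, finsetSum_coeff, coeff_monomial]
      exact Finset.sum_eq_zero fun k _ => if_neg fun hk =>
        hne (Finset.mem_image.2 ⟨k, Finset.mem_univ _, hk⟩)
    refine (Finset.card_le_card this).trans (Finset.card_image_le.trans ?_)
    simpa using hcard
  have hP : P = 0 := by
    refine eq_zero_of_card_support_le (T := Finset.univ.map ⟨τ, hτ⟩) ?_ (by simpa using hsupp)
    intro t ht
    obtain ⟨i, -, rfl⟩ := Finset.mem_map.1 ht
    refine ⟨hpos i, ?_⟩
    have := congrFun h i
    simp only [mulVec, dotProduct, curveMatrix, of_apply, Pi.zero_apply] at this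
    simp only [P, eval_finsetSum, eval_monomial, Function.Embedding.coeFn_mk]
    rw [← this]
    exact Finset.sum_congr rfl fun _ _ => mul_comm _ _
  funext k
  have := congrArg (fun Q => coeff Q (curveExponent k)) hP
  simpa [P, coeff_monomial, curveExponent_injective.eq_iff, Fin.val_inj] using this

/-- A quadratic form vanishing on sufficiently many points of the curve is zero. -/
theorem add_transpose_eq_zero_of_curveMatrix {ι : Type*} [Fintype ι] {d : ℕ} {τ : ι → ℝ}
    (hτ : Function.Injective τ) (hpos : ∀ i, 0 < τ i) (hcard : (d + 2).choose 2 ≤ Fintype.card ι)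
    {S : Matrix (Fin (d + 1)) (Fin (d + 1)) ℝ}
    (h : ∀ i, curveMatrix d τ i ⬝ᵥ (S *ᵥ curveMatrix d τ i) = 0) : S + Sᵀ = 0 := by
  let P : ℝ[X] := ∑ k : Fin (d + 1), ∑ l : Fin (d + 1),
    monomial (curveExponent k + curveExponent l) (S k l)
  -- Exponents of `P` are indexed by unordered pairs, whence at most `(d + 2).choose 2` terms.
  let E : Sym2 (Fin (d + 1)) → ℕ :=
    Sym2.lift ⟨fun k l => curveExponent k + curveExponent l, fun _ _ => add_comm _ _⟩
  have hsupp : P.support.card ≤ Fintype.card ι := by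
    have : P.support ⊆ Finset.univ.image E := by
      intro e he
      by_contra hne
      refine mem_support_iff.1 he ?_
      simp only [P, finsetSum_coeff, coeff_monomial]
      exact Finset.sum_eq_zero fun k _ => Finset.sum_eq_zero fun l _ => if_neg fun hkl =>
        hne (Finset.mem_image.2 ⟨s(k, l), Finset.mem_univ _, hkl⟩)
    refine (Finset.card_le_card this).trans (Finset.card_image_le.trans ?_)
    simpa [Sym2.card] using hcard
  have hP : P = 0 := by
    refine eq_zero_of_card_support_le (T := Finset.univ.map ⟨τ, hτ⟩) ?_ (by simpa using hsupp)
    intro t ht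
    obtain ⟨i, -, rfl⟩ := Finset.mem_map.1 ht
    refine ⟨hpos i, ?_⟩
    have := h i
    simp only [mulVec, dotProduct, curveMatrix, of_apply, Finset.mul_sum] at this
    simp only [P, eval_finsetSum, eval_monomial, Function.Embedding.coeFn_mk]
    rw [← this]
    exact Finset.sum_congr rfl fun _ _ => Finset.sum_congr rfl fun _ _ => by ring
  ext k l
  have := congrArg (fun Q => coeff Q (curveExponent k + curveExponent l)) hP
  -- No other pair shares this exponent, so the coefficient is `S k l + S l k`, or `S k k` on the
  -- diagonal.
  have hiff : ∀ a b : Fin (d + 1),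
      curveExponent a + curveExponent b = curveExponent k + curveExponent l ↔
        (a = k ∧ b = l) ∨ (a = l ∧ b = k) := by
    intro a b
    constructor
    · intro h
      have := curveExponent_add_inj h
      simpa [Sym2.eq_iff, Fin.val_inj] using this
    · rintro (⟨rfl, rfl⟩ | ⟨rfl, rfl⟩)
      · rfl
      · exact add_comm _ _
  simp only [P, finsetSum_coeff, coeff_monomial, hiff, coeff_zero] at this
  by_cases hkl : k = l
  · subst hkl
    simp only [or_self, ite_and, Finset.sum_ite_irrel, Finset.sum_ite_eq', Finset.mem_univ,
      Finset.sum_const_zero, if_true] at this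
    simp [this]
  · have hsplit : ∀ a b : Fin (d + 1), (if (a = k ∧ b = l) ∨ (a = l ∧ b = k) then S a b else 0) =
        (if a = k then if b = l then S a b else 0 else 0) +
        (if a = l then if b = k then S a b else 0 else 0) := by
      intro a b
      split_ifs <;> simp_all
    simp only [hsplit, Finset.sum_add_distrib, Finset.sum_ite_irrel, Finset.sum_ite_eq',
      Finset.mem_univ, Finset.sum_const_zero, if_true] at this
    simpa using this

end MonomialCurve

/-! ### Infinitesimal rigidity of complete bipartite frameworks -/

section BolkerRoth

open Matrix

theorem exists_pos_forall_le {ι : Type*} [Finite ι] {f : ι → ℝ} (hf : ∀ i, 0 < f i) :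
    ∃ c, 0 < c ∧ ∀ i, c ≤ f i := by
  cases isEmpty_or_nonempty ι
  · exact ⟨1, one_pos, fun i => isEmptyElim i⟩
  · obtain ⟨i, hi⟩ := Finite.exists_min f
    exact ⟨f i, hf i, hi⟩

/-- A linear map is bounded below on some complement of its kernel. -/
theorem LinearMap.exists_projection_bound {α σ : Type*} [Fintype α] [Fintype σ]
    (F : (α → ℝ) →ₗ[ℝ] (σ → ℝ)) :
    ∃ P : (α → ℝ) →ₗ[ℝ] LinearMap.ker F, ∃ c, 0 < c ∧
      ∀ z, P z = 0 → c * ∑ a, z a ^ 2 ≤ ∑ s, F z s ^ 2 := by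
  obtain ⟨P, hP⟩ := (LinearMap.ker F).subtype.exists_leftInverse_of_injective
    (Submodule.ker_subtype _)
  have hinj : LinearMap.ker (F.prod P) = ⊥ := by
    refine LinearMap.ker_eq_bot'.2 fun z hz => ?_
    have hz1 : F z = 0 := congrArg Prod.fst hz
    have hz2 : P z = 0 := congrArg Prod.snd hz
    have := LinearMap.congr_fun hP ⟨z, hz1⟩
    simp only [LinearMap.comp_apply, Submodule.subtype_apply, hz2, LinearMap.id_apply] at this
    exact (congrArg Subtype.val this).symm
  obtain ⟨K, hK, hG⟩ := (F.prod P).exists_antilipschitzWith hinj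
  have hK' : (0 : ℝ) < K := hK
  -- The cardinality passes from the sup norm to the sum of squares; the `+ 1` keeps the constant
  -- positive when `α` is empty.
  refine ⟨P, ((K : ℝ) ^ 2 * (Fintype.card α + 1))⁻¹, by positivity, fun z hz => ?_⟩
  have h1 : ‖z‖ ≤ K * ‖F z‖ := by
    have := hG.le_mul_norm_sub z 0
    simpa [hz] using this
  have h2 : ∑ a, z a ^ 2 ≤ (Fintype.card α + 1) * ‖z‖ ^ 2 := by
    calc ∑ a, z a ^ 2 ≤ ∑ _a : α, ‖z‖ ^ 2 := Finset.sum_le_sum fun a _ => by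
          rw [← sq_abs]
          exact pow_le_pow_left₀ (abs_nonneg _) (norm_le_pi_norm z a) 2
      _ ≤ _ := by
          simp only [Finset.sum_const, Finset.card_univ, nsmul_eq_mul]
          nlinarith [sq_nonneg ‖z‖]
  have h3 : ‖F z‖ ^ 2 ≤ ∑ s, F z s ^ 2 := by
    have hnn : 0 ≤ ∑ s, F z s ^ 2 := Finset.sum_nonneg fun _ _ => sq_nonneg _
    refine (Real.le_sqrt (norm_nonneg _) hnn).1 ?_
    refine (pi_norm_le_iff_of_nonneg (Real.sqrt_nonneg _)).2 fun s => ?_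
    refine Real.le_sqrt_of_sq_le ?_
    rw [Real.norm_eq_abs, sq_abs]
    exact Finset.single_le_sum (f := fun s => F z s ^ 2) (fun _ _ => sq_nonneg _)
      (Finset.mem_univ s)
  rw [inv_mul_le_iff₀ (by positivity)]
  calc ∑ a, z a ^ 2 ≤ (Fintype.card α + 1) * ‖z‖ ^ 2 := h2
    _ ≤ (Fintype.card α + 1) * (K * ‖F z‖) ^ 2 := by gcongr
    _ = (K : ℝ) ^ 2 * (Fintype.card α + 1) * ‖F z‖ ^ 2 := by ring
    _ ≤ _ := by gcongr

theorem Matrix.exists_left_inverse_of_mulVec {ι n : Type*} [Fintype ι] [Fintype n]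
    [DecidableEq ι] [DecidableEq n]
    {A : Matrix ι n ℝ} (h : ∀ c, A *ᵥ c = 0 → c = 0) : ∃ A' : Matrix n ι ℝ, A' * A = 1 := by
  obtain ⟨g, hg⟩ := (Matrix.toLin' A).exists_leftInverse_of_injective
    (LinearMap.ker_eq_bot'.2 fun c hc => h c (by simpa using hc))
  refine ⟨LinearMap.toMatrix' g, ?_⟩
  rw [← LinearMap.toMatrix'_toLin' A, ← LinearMap.toMatrix'_comp, hg, LinearMap.toMatrix'_id]

theorem Matrix.exists_factorization_of_mul_transpose_eq {ι κ n : Type*} [Fintype ι] [Fintype κ]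
    [Fintype n] [DecidableEq ι] [DecidableEq κ] [DecidableEq n]
    {A X : Matrix ι n ℝ} {B Y : Matrix κ n ℝ}
    (hA : ∀ c, A *ᵥ c = 0 → c = 0) (hB : ∀ c, B *ᵥ c = 0 → c = 0) (h : X * Bᵀ = -(A * Yᵀ)) :
    ∃ S : Matrix n n ℝ, X = A * S ∧ Y = -(B * Sᵀ) := by
  obtain ⟨A', hA'⟩ := exists_left_inverse_of_mulVec hA
  obtain ⟨B', hB'⟩ := exists_left_inverse_of_mulVec hB
  have hB'' : Bᵀ * B'ᵀ = 1 := by rw [← transpose_mul, hB', transpose_one]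
  refine ⟨A' * X, ?_, ?_⟩
  · have h1 : A * (A' * X) * Bᵀ = X * Bᵀ := by
      rw [Matrix.mul_assoc, Matrix.mul_assoc, h, Matrix.mul_neg, Matrix.mul_neg,
        ← Matrix.mul_assoc A' A, hA', Matrix.one_mul]
    have h2 := congrArg (· * B'ᵀ) h1
    simpa only [Matrix.mul_assoc _ Bᵀ, hB'', Matrix.mul_one] using h2.symm
  · have h1 : A' * X * Bᵀ = -Yᵀ := by
      rw [Matrix.mul_assoc, h, Matrix.mul_neg, ← Matrix.mul_assoc, hA', Matrix.one_mul]
    have h2 := congrArg transpose h1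
    rw [transpose_mul, transpose_transpose, transpose_neg, transpose_transpose] at h2
    rw [h2, neg_neg]

/-- The space of skew-symmetric matrices. -/
def skewMatrices (N : ℕ) : Submodule ℝ (Matrix (Fin N) (Fin N) ℝ) where
  carrier := {S | S + Sᵀ = 0}
  zero_mem' := by simp
  add_mem' {S T} hS hT := by
    simp only [Set.mem_ofPred_eq, transpose_add] at *
    rw [add_add_add_comm, hS, hT, add_zero]
  smul_mem' c S hS := by
    simp only [Set.mem_ofPred_eq, transpose_smul] at *
    rw [← smul_add, hS, smul_zero]

theorem finrank_skewMatrices_le (N : ℕ) : Module.finrank ℝ (skewMatrices N) ≤ N.choose 2 := by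
  let R : skewMatrices N →ₗ[ℝ] ((Σ l : Fin N, Fin l) → ℝ) :=
    { toFun := fun S q => S.1 q.1 ⟨q.2, q.2.2.trans q.1.2⟩
      map_add' := fun _ _ => rfl
      map_smul' := fun _ _ => rfl }
  have hR : Function.Injective R := by
    refine (injective_iff_map_eq_zero R).2 fun S hS => Subtype.ext ?_
    have hlt : ∀ l k : Fin N, k < l → S.1 l k = 0 := fun l k hkl => congrFun hS ⟨l, ⟨k, hkl⟩⟩
    have hskew : ∀ l k, S.1 l k + S.1 k l = 0 := fun l k => congrFun (congrFun S.2 l) k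
    ext l k
    rcases lt_trichotomy k l with h | h | h
    · exact hlt l k h
    · subst h
      have := hskew k k
      change S.1 k k = 0
      linarith
    · have := hskew l k
      rw [hlt k l h, add_zero] at this
      exact this
  refine (LinearMap.finrank_le_finrank_of_injective hR).trans ?_
  rw [Module.finrank_fintype_fun_eq_card, Fintype.card_sigma]
  simp only [Fintype.card_fin]
  rw [Fin.sum_univ_eq_sum_range (fun i => i) N, Finset.sum_range_id, Nat.choose_two_right]

namespace SimpleGraph

variable {ι κ : Type*} {d : ℕ}

theorem sum_sub_mul_eq_zero_of_edgeDirection {V : Type*} (p : V → EuclideanSpace ℝ (Fin d))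
    (u v : V) (y : Fin d → ℝ) (h : ∑ k, edgeDirection p u v k * y k = 0) :
    ∑ k, (p u k - p v k) * y k = 0 := by
  unfold edgeDirection at h
  split_ifs at h with huv
  · simp [huv]
  · have hne : ‖p u - p v‖⁻¹ ≠ 0 := inv_ne_zero (norm_ne_zero_iff.2 (sub_ne_zero.2 huv))
    refine (mul_eq_zero.1 (?_ : ‖p u - p v‖⁻¹ * _ = 0)).resolve_left hne
    rw [← h, Finset.mul_sum]
    exact Finset.sum_congr rfl fun k _ => by simp [mul_assoc]

/-- The linear map whose kernel is the space of infinitesimal motions of a bipartite framework. -/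
noncomputable def bipartiteStretch (p : ι ⊕ κ → EuclideanSpace ℝ (Fin d)) :
    ((ι ⊕ κ) × Fin d → ℝ) →ₗ[ℝ] (ι × κ → ℝ) where
  toFun z q := ∑ k, edgeDirection p (.inl q.1) (.inr q.2) k * (z (.inl q.1, k) - z (.inr q.2, k))
  map_add' z z' := by
    funext q
    simp only [Pi.add_apply, ← Finset.sum_add_distrib]
    exact Finset.sum_congr rfl fun k _ => by ring
  map_smul' c z := by
    funext q
    simp only [Pi.smul_apply, smul_eq_mul, RingHom.id_apply, Finset.mul_sum]
    exact Finset.sum_congr rfl fun k _ => by ring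

/-- The framework placing the vertices on the monomial curve with the given parameters. -/
noncomputable def curvePlacement {V : Type*} (d : ℕ) (τ : V → ℝ) (w : V) :
    EuclideanSpace ℝ (Fin d) :=
  WithLp.toLp 2 fun k => curveMatrix d τ w k.succ

/-- An affine function vanishing at `d + 1` points of the curve is zero. Hence the directions from
any point `q` to these points span. -/
theorem eq_zero_of_forall_sub_mul_eq_zero [Fintype ι] {τ : ι → ℝ} (hτ : Function.Injective τ)
    (hpos : ∀ w, 0 < τ w) (hcard : d + 1 ≤ Fintype.card ι) (q y : Fin d → ℝ)
    (h : ∀ i, ∑ k, (q k - curvePlacement d τ i k) * y k = 0) : y = 0 := by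
  have h0 : curveMatrix d τ *ᵥ (Fin.cons (-∑ k, q k * y k) y : Fin (d + 1) → ℝ) = 0 := by
    funext i
    have := h i
    simp only [sub_mul, Finset.sum_sub_distrib, curvePlacement] at this
    simp only [mulVec, dotProduct, Fin.sum_univ_succ, curveMatrix_zero, Fin.cons_zero,
      Fin.cons_succ, Pi.zero_apply]
    linarith
  have := curveMatrix_mulVec_injective hτ hpos hcard h0
  funext k
  simpa using congrFun this k.succ

/-- **Bolker–Roth**: a complete bipartite framework on the monomial curve has only trivial
infinitesimal motions. -/
theorem finrank_ker_bipartiteStretch_le [Fintype ι] [Fintype κ] {τ : ι ⊕ κ → ℝ}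
    (hτ : Function.Injective τ) (hpos : ∀ w, 0 < τ w) (hι : d + 1 ≤ Fintype.card ι)
    (hκ : d + 1 ≤ Fintype.card κ) (hcard : (d + 2).choose 2 ≤ Fintype.card ι + Fintype.card κ) :
    Module.finrank ℝ (LinearMap.ker (bipartiteStretch (curvePlacement d τ))) ≤
      (d + 1).choose 2 := by
  classical
  let Ψ : Matrix (Fin (d + 1)) (Fin (d + 1)) ℝ →ₗ[ℝ] ((ι ⊕ κ) × Fin d → ℝ) :=
    { toFun := fun S y => (curveMatrix d τ * S) y.1 y.2.succ
      map_add' := fun S T => by funext y; simp [Matrix.mul_add]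
      map_smul' := fun c S => by funext y; simp }
  suffices hle : LinearMap.ker (bipartiteStretch (curvePlacement d τ)) ≤
      (skewMatrices (d + 1)).map Ψ from
    (Submodule.finrank_mono hle).trans
      ((Submodule.finrank_map_le _ _).trans (finrank_skewMatrices_le _))
  intro z hz
  let A : Matrix ι (Fin (d + 1)) ℝ := curveMatrix d (τ ∘ Sum.inl)
  let B : Matrix κ (Fin (d + 1)) ℝ := curveMatrix d (τ ∘ Sum.inr)
  -- The extra coordinate makes row `i` of `X` orthogonal to row `i` of `A`, and makes the bilinear
  -- edge condition read `X * Bᵀ = -(A * Yᵀ)`.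
  let X : Matrix ι (Fin (d + 1)) ℝ := Matrix.of fun i =>
    Fin.cons (-∑ k : Fin d, A i k.succ * z (.inl i, k)) fun k => z (.inl i, k)
  let Y : Matrix κ (Fin (d + 1)) ℝ := Matrix.of fun j =>
    Fin.cons (-∑ k : Fin d, B j k.succ * z (.inr j, k)) fun k => z (.inr j, k)
  have hA0 : ∀ i, A i 0 = 1 := curveMatrix_zero d _
  have hB0 : ∀ j, B j 0 = 1 := curveMatrix_zero d _
  have hXY : X * Bᵀ = -(A * Yᵀ) := by
    ext i j
    have h1 := sum_sub_mul_eq_zero_of_edgeDirection (curvePlacement d τ) (.inl i) (.inr j)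
      (fun k => z (.inl i, k) - z (.inr j, k)) (congrFun (LinearMap.mem_ker.1 hz) (i, j))
    have h2 : ∑ k : Fin d, (A i k.succ - B j k.succ) * (z (.inl i, k) - z (.inr j, k)) = 0 := h1
    simp only [sub_mul, mul_sub, Finset.sum_sub_distrib] at h2
    simp only [Matrix.neg_apply, mul_apply, transpose_apply, Fin.sum_univ_succ, hA0, hB0, X, Y, of_apply,
      Fin.cons_zero, Fin.cons_succ]
    simp only [mul_comm (z _) (B j _)]
    linarith
  obtain ⟨S, hXS, hYS⟩ := exists_factorization_of_mul_transpose_eq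
    (fun c => curveMatrix_mulVec_injective (hτ.comp Sum.inl_injective) (fun _ => hpos _) hι)
    (fun c => curveMatrix_mulVec_injective (hτ.comp Sum.inr_injective) (fun _ => hpos _) hκ) hXY
  -- By these orthogonalities the quadratic form of `S` vanishes at all vertices, which lie on no
  -- common nonzero quadric.
  have hS : S + Sᵀ = 0 := by
    refine add_transpose_eq_zero_of_curveMatrix hτ hpos (by simpa using hcard) ?_
    rintro (i | j)
    · change A i ⬝ᵥ (S *ᵥ A i) = 0
      have hX : A i ᵥ* S = X i := by rw [hXS]; rfl
      rw [dotProduct_mulVec, hX]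
      simp only [dotProduct, Fin.sum_univ_succ, X, hA0, of_apply, Fin.cons_zero, Fin.cons_succ,
        mul_comm (z _)]
      ring
    · change B j ⬝ᵥ (S *ᵥ B j) = 0
      have hY : S *ᵥ B j = -Y j := by
        rw [hYS, ← vecMul_transpose]
        funext k
        simp only [vecMul, dotProduct, Pi.neg_apply, Matrix.neg_apply, mul_apply, neg_neg]
        rfl
      rw [hY]
      simp only [dotProduct, Fin.sum_univ_succ, Y, hB0, of_apply, Fin.cons_zero, Fin.cons_succ,
        Pi.neg_apply, mul_neg, Finset.sum_neg_distrib]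
      ring
  refine ⟨S, hS, ?_⟩
  have hST : Sᵀ = -S := by rw [← add_eq_zero_iff_neg_eq.1 hS]
  rw [hST, Matrix.mul_neg, neg_neg] at hYS
  funext ⟨w, k⟩
  rcases w with i | j
  · change (A * S) i k.succ = _
    rw [← hXS]; simp [X]
  · change (B * S) j k.succ = _
    rw [← hYS]; simp [Y]

end SimpleGraph

end BolkerRoth

/-! ### Blowing up vertices into clusters -/

theorem sum_sum_sub_sq_eq {α β : Type*} (A : Finset α) (B : Finset β) (ξ : α → ℝ) (η : β → ℝ)
    {ξ₀ η₀ : ℝ} (hξ : ∑ u ∈ A, (ξ u - ξ₀) = 0) (hη : ∑ v ∈ B, (η v - η₀) = 0) :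
    ∑ u ∈ A, ∑ v ∈ B, (ξ u - η v) ^ 2 = A.card * B.card * (ξ₀ - η₀) ^ 2 +
      B.card * ∑ u ∈ A, (ξ u - ξ₀) ^ 2 + A.card * ∑ v ∈ B, (η v - η₀) ^ 2 := by
  have h : ∀ u ∈ A, ∑ v ∈ B, (ξ u - η v) ^ 2 = B.card * (ξ₀ - η₀) ^ 2 +
      B.card * (ξ u - ξ₀) ^ 2 + ∑ v ∈ B, (η v - η₀) ^ 2 +
      2 * B.card * (ξ₀ - η₀) * (ξ u - ξ₀) := by
    intro u _
    have : ∀ v ∈ B, (ξ u - η v) ^ 2 = ((ξ₀ - η₀) ^ 2 + (ξ u - ξ₀) ^ 2 +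
        2 * (ξ₀ - η₀) * (ξ u - ξ₀)) + (η v - η₀) ^ 2 - 2 * (ξ u - η₀) * (η v - η₀) := by
      intro v _; ring
    rw [Finset.sum_congr rfl this, Finset.sum_sub_distrib, Finset.sum_add_distrib,
      Finset.sum_const, nsmul_eq_mul, ← Finset.mul_sum, hη]
    ring
  rw [Finset.sum_congr rfl h, Finset.sum_add_distrib, Finset.sum_add_distrib,
    Finset.sum_add_distrib]
  simp only [← Finset.mul_sum, hξ, Finset.sum_const, nsmul_eq_mul]
  ring

section Cluster

variable {α β ι κ : Type*} [Fintype α] [Fintype β] [Fintype ι] [Fintype κ] {d : ℕ}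

theorem sum_sq_le_of_cluster (f : α → ι) (x : α → Fin d → ℝ) (X : ι → Fin d → ℝ) :
    ∑ u, ∑ k, x u k ^ 2 ≤
      2 * Fintype.card α * ∑ i, ∑ k, X i k ^ 2 + 2 * ∑ u, ∑ k, (x u k - X (f u) k) ^ 2 := by
  have h1 : ∑ u, ∑ k, X (f u) k ^ 2 ≤ Fintype.card α * ∑ i, ∑ k, X i k ^ 2 := by
    rw [← nsmul_eq_mul, ← Finset.card_univ]
    refine Finset.sum_le_card_nsmul _ _ _ fun u _ => ?_
    exact Finset.single_le_sum (f := fun i => ∑ k, X i k ^ 2)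
      (fun i _ => Finset.sum_nonneg fun k _ => sq_nonneg _) (Finset.mem_univ (f u))
  have h2 : ∑ u, ∑ k, x u k ^ 2 ≤
      ∑ u, ∑ k, (2 * X (f u) k ^ 2 + 2 * (x u k - X (f u) k) ^ 2) :=
    Finset.sum_le_sum fun u _ => Finset.sum_le_sum fun k _ => by
      nlinarith [sq_nonneg (x u k - 2 * X (f u) k)]
  simp only [Finset.sum_add_distrib, ← Finset.mul_sum] at h2
  linarith

variable [DecidableEq ι] [DecidableEq κ]

/-- Replacing the vertices of a bipartite framework by clusters: lower bounds for the small
framework give lower bounds for the large one. -/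
theorem le_sum_sum_sq_of_cluster (f : α → ι) (g : β → κ) (D : ι → κ → Fin d → ℝ)
    {c₁ c₂ a b r : ℝ} (ha : 0 ≤ a) (hb : 0 ≤ b)
    (hf : ∀ i, a ≤ (Finset.univ.filter fun u => f u = i).card)
    (hg : ∀ j, b ≤ (Finset.univ.filter fun v => g v = j).card)
    (hι : ∀ i (y : Fin d → ℝ), c₁ * ∑ k, y k ^ 2 ≤ ∑ j, (∑ k, D i j k * y k) ^ 2)
    (hκ : ∀ j (y : Fin d → ℝ), c₁ * ∑ k, y k ^ 2 ≤ ∑ i, (∑ k, D i j k * y k) ^ 2)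
    (x : α → Fin d → ℝ) (y : β → Fin d → ℝ) (X : ι → Fin d → ℝ) (Y : κ → Fin d → ℝ)
    (hX : ∀ i k, ∑ u with f u = i, (x u k - X i k) = 0)
    (hY : ∀ j k, ∑ v with g v = j, (y v k - Y j k) = 0)
    (hXY : c₂ * (∑ i, ∑ k, X i k ^ 2 + ∑ j, ∑ k, Y j k ^ 2) ≤
      ∑ i, ∑ j, (∑ k, D i j k * (X i k - Y j k)) ^ 2)
    (hr : 0 ≤ r) (hrα : r * (2 * Fintype.card α) ≤ a * b * c₂)
    (hrβ : r * (2 * Fintype.card β) ≤ a * b * c₂) (hra : r * 2 ≤ a * c₁) (hrb : r * 2 ≤ b * c₁) :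
    r * (∑ u, ∑ k, x u k ^ 2 + ∑ v, ∑ k, y v k ^ 2) ≤
      ∑ u, ∑ v, (∑ k, D (f u) (g v) k * (x u k - y v k)) ^ 2 := by
  set δ : α → Fin d → ℝ := fun u k => x u k - X (f u) k with hδ
  set ε : β → Fin d → ℝ := fun v k => y v k - Y (g v) k with hε
  have hsplit : ∑ u, ∑ v, (∑ k, D (f u) (g v) k * (x u k - y v k)) ^ 2 =
      ∑ i, ∑ j, ∑ u with f u = i, ∑ v with g v = j,
        (∑ k, D i j k * x u k - ∑ k, D i j k * y v k) ^ 2 := by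
    rw [← Finset.sum_fiberwise Finset.univ f]
    refine Finset.sum_congr rfl fun i _ => ?_
    conv_rhs => rw [Finset.sum_comm]
    refine Finset.sum_congr rfl fun u hu => ?_
    rw [← Finset.sum_fiberwise Finset.univ g]
    refine Finset.sum_congr rfl fun j _ => Finset.sum_congr rfl fun v hv => ?_
    rw [(Finset.mem_filter.1 hu).2, (Finset.mem_filter.1 hv).2, ← Finset.sum_sub_distrib]
    simp only [mul_sub]
  -- For a fixed pair of clusters the direction is constant, so the variance identity applies to the
  -- scalar projections.
  have hterm : ∀ i j, a * b * (∑ k, D i j k * (X i k - Y j k)) ^ 2 +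
      b * ∑ u with f u = i, (∑ k, D i j k * δ u k) ^ 2 +
      a * ∑ v with g v = j, (∑ k, D i j k * ε v k) ^ 2 ≤
      ∑ u with f u = i, ∑ v with g v = j,
        (∑ k, D i j k * x u k - ∑ k, D i j k * y v k) ^ 2 := by
    intro i j
    rw [sum_sum_sub_sq_eq (ξ₀ := ∑ k, D i j k * X i k) (η₀ := ∑ k, D i j k * Y j k)]
    · have e1 : ∀ u ∈ Finset.univ.filter (fun u => f u = i), (∑ k, D i j k * δ u k) ^ 2 =
          (∑ k, D i j k * x u k - ∑ k, D i j k * X i k) ^ 2 := by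
        intro u hu
        simp only [hδ, (Finset.mem_filter.1 hu).2, mul_sub, Finset.sum_sub_distrib]
      have e2 : ∀ v ∈ Finset.univ.filter (fun v => g v = j), (∑ k, D i j k * ε v k) ^ 2 =
          (∑ k, D i j k * y v k - ∑ k, D i j k * Y j k) ^ 2 := by
        intro v hv
        simp only [hε, (Finset.mem_filter.1 hv).2, mul_sub, Finset.sum_sub_distrib]
      rw [Finset.sum_congr rfl e1, Finset.sum_congr rfl e2]
      simp only [mul_sub, Finset.sum_sub_distrib]
      have hfi := hf i
      have hgj := hg j
      gcongr
    · simp only [← Finset.sum_sub_distrib, ← mul_sub]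
      rw [Finset.sum_comm]
      exact Finset.sum_eq_zero fun k _ => by rw [← Finset.mul_sum, hX, mul_zero]
    · simp only [← Finset.sum_sub_distrib, ← mul_sub]
      rw [Finset.sum_comm]
      exact Finset.sum_eq_zero fun k _ => by rw [← Finset.mul_sum, hY, mul_zero]
  have hδsum : c₁ * ∑ u, ∑ k, δ u k ^ 2 ≤
      ∑ i, ∑ j, ∑ u with f u = i, (∑ k, D i j k * δ u k) ^ 2 := by
    rw [Finset.mul_sum, ← Finset.sum_fiberwise Finset.univ f]
    refine Finset.sum_le_sum fun i _ => ?_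
    rw [Finset.sum_comm]
    exact Finset.sum_le_sum fun u _ => hι i _
  have hεsum : c₁ * ∑ v, ∑ k, ε v k ^ 2 ≤
      ∑ i, ∑ j, ∑ v with g v = j, (∑ k, D i j k * ε v k) ^ 2 := by
    rw [Finset.mul_sum, ← Finset.sum_fiberwise Finset.univ g, Finset.sum_comm]
    refine Finset.sum_le_sum fun j _ => ?_
    rw [Finset.sum_comm]
    exact Finset.sum_le_sum fun v _ => hκ j _
  rw [hsplit]
  refine le_trans ?_ (Finset.sum_le_sum fun i _ => Finset.sum_le_sum fun j _ => hterm i j)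
  simp only [Finset.sum_add_distrib, ← Finset.mul_sum]
  have hx := mul_le_mul_of_nonneg_left (sum_sq_le_of_cluster f x X) hr
  have hy := mul_le_mul_of_nonneg_left (sum_sq_le_of_cluster g y Y) hr
  have hXn : 0 ≤ ∑ i, ∑ k, X i k ^ 2 :=
    Finset.sum_nonneg fun _ _ => Finset.sum_nonneg fun _ _ => sq_nonneg _
  have hYn : 0 ≤ ∑ j, ∑ k, Y j k ^ 2 :=
    Finset.sum_nonneg fun _ _ => Finset.sum_nonneg fun _ _ => sq_nonneg _
  have hδn : 0 ≤ ∑ u, ∑ k, δ u k ^ 2 :=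
    Finset.sum_nonneg fun _ _ => Finset.sum_nonneg fun _ _ => sq_nonneg _
  have hεn : 0 ≤ ∑ v, ∑ k, ε v k ^ 2 :=
    Finset.sum_nonneg fun _ _ => Finset.sum_nonneg fun _ _ => sq_nonneg _
  have k1 := mul_le_mul_of_nonneg_right hrα hXn
  have k2 := mul_le_mul_of_nonneg_right hrβ hYn
  have k3 := mul_le_mul_of_nonneg_right hrb hδn
  have k4 := mul_le_mul_of_nonneg_right hra hεn
  have m1 := mul_le_mul_of_nonneg_left hXY (mul_nonneg ha hb)
  have m2 := mul_le_mul_of_nonneg_left hδsum hb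
  have m3 := mul_le_mul_of_nonneg_left hεsum ha
  simp only [hδ, hε] at *
  linarith

/-- The linear map averaging over the clusters of a bipartite framework. -/
noncomputable def clusterAverage (f : α → ι) (g : β → κ) (d : ℕ) :
    ((α ⊕ β) × Fin d → ℝ) →ₗ[ℝ] ((ι ⊕ κ) × Fin d → ℝ) where
  toFun x y := Sum.elim
    (fun i => (∑ u with f u = i, x (.inl u, y.2)) / (Finset.univ.filter fun u => f u = i).card)
    (fun j => (∑ v with g v = j, x (.inr v, y.2)) / (Finset.univ.filter fun v => g v = j).card) y.1
  map_add' x x' := by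
    funext ⟨w, k⟩
    rcases w with i | j <;> simp [Finset.sum_add_distrib, add_div]
  map_smul' c x := by
    funext ⟨w, k⟩
    rcases w with i | j <;> simp [← Finset.mul_sum, mul_div_assoc]

end Cluster

theorem sum_sub_average_eq_zero {α : Type*} {s : Finset α} (hs : 0 < (s.card : ℝ)) (x : α → ℝ) :
    ∑ u ∈ s, (x u - (∑ v ∈ s, x v) / s.card) = 0 := by
  rw [Finset.sum_sub_distrib, Finset.sum_const, nsmul_eq_mul, mul_div_cancel₀ _ hs.ne', sub_self]

/-- The residue map `Fin n → Fin s`. -/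
def residueMap (n s : ℕ) (hs : 0 < s) (u : Fin n) : Fin s := ⟨u % s, Nat.mod_lt _ hs⟩

theorem le_card_fiber_residueMap {n s : ℕ} (hs : 0 < s) (hsn : s ≤ n) (i : Fin s) :
    (n : ℝ) / (2 * s) ≤ (Finset.univ.filter fun u => residueMap n s hs u = i).card := by
  have h1 : n / s ≤ (Finset.univ.filter fun u => residueMap n s hs u = i).card := by
    have hlt : ∀ q : Fin (n / s), s * q + i < n := fun q => by
      have h1 : s * (q + 1) ≤ s * (n / s) := Nat.mul_le_mul_left s q.2
      have h2 := Nat.mul_div_le n s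
      have h3 := i.2
      rw [mul_add] at h1
      omega
    let e : Fin (n / s) ↪ Fin n := ⟨fun q => ⟨s * q + i, hlt q⟩, fun q q' h => by
      simp only [Fin.mk.injEq, add_left_inj] at h
      exact Fin.ext (Nat.eq_of_mul_eq_mul_left hs h)⟩
    have := Finset.card_le_card (s := Finset.univ.map e)
      (t := Finset.univ.filter fun u => residueMap n s hs u = i) ?_
    · simpa using this
    · intro u hu
      obtain ⟨q, -, rfl⟩ := Finset.mem_map.1 hu
      refine Finset.mem_filter.2 ⟨Finset.mem_univ _, Fin.ext ?_⟩
      change (s * q + i) % s = i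
      rw [Nat.mul_add_mod, Nat.mod_eq_of_lt i.2]
  have h2 : n ≤ n / s * (2 * s) := by
    have := Nat.lt_mul_div_succ n hs
    have h3 : 1 ≤ n / s := (Nat.one_le_div_iff hs).2 hsn
    nlinarith
  rw [div_le_iff₀ (by positivity)]
  calc (n : ℝ) ≤ ((n / s * (2 * s) : ℕ) : ℝ) := by exact_mod_cast h2
    _ = ((n / s : ℕ) : ℝ) * (2 * s) := by push_cast; ring
    _ ≤ _ := by gcongr

/-! ### Assembling the bound -/

namespace SimpleGraph

theorem exists_pos_forall_le_algebraicConnectivity {d s t : ℕ} (hd : 1 ≤ d) (hs : d + 1 ≤ s)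
    (ht : d + 1 ≤ t) (hst : (d + 2).choose 2 ≤ s + t) :
    ∃ c : ℝ, 0 < c ∧ ∀ n m : ℕ, s ≤ n → t ≤ m →
      c * ((min n m : ℕ) : ℝ) ≤
        (completeBipartiteGraph (Fin n) (Fin m)).algebraicConnectivity d := by
  let τ : Fin s ⊕ Fin t → ℝ := fun w => (finSumFinEquiv w : ℕ) + 1
  have hτ : Function.Injective τ := fun w w' h => by
    simpa [τ, Fin.val_inj] using h
  have hpos : ∀ w, 0 < τ w := fun w => by positivity
  let p := curvePlacement d τ
  let D : Fin s → Fin t → Fin d → ℝ := fun i j => (edgeDirection p (.inl i) (.inr j)).ofLp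
  have hker := finrank_ker_bipartiteStretch_le hτ hpos (by simpa using hs) (by simpa using ht)
    (by simpa using hst)
  obtain ⟨P, c₂, hc₂, hP⟩ := (bipartiteStretch p).exists_projection_bound
  have hι : ∀ i, ∃ c, 0 < c ∧ ∀ y : Fin d → ℝ,
      c * ∑ k, y k ^ 2 ≤ ∑ j, (∑ k, D i j k * y k) ^ 2 := by
    intro i
    let F : (Fin d → ℝ) →ₗ[ℝ] (Fin t → ℝ) := Matrix.mulVecLin (Matrix.of (D i))
    obtain ⟨Q, c, hc, hQ⟩ := F.exists_projection_bound
    -- The kernel of `F` is trivial, so the condition `Q y = 0` is automatic.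
    refine ⟨c, hc, fun y => hQ y (Subtype.ext ?_)⟩
    refine eq_zero_of_forall_sub_mul_eq_zero (hτ.comp Sum.inr_injective) (fun _ => hpos _)
      (by simpa using ht) (p (.inl i)) _ fun j => ?_
    exact sum_sub_mul_eq_zero_of_edgeDirection p (.inl i) (.inr j) _ (congrFun (Q y).2 j)
  have hκ : ∀ j, ∃ c, 0 < c ∧ ∀ y : Fin d → ℝ,
      c * ∑ k, y k ^ 2 ≤ ∑ i, (∑ k, D i j k * y k) ^ 2 := by
    intro j
    let F : (Fin d → ℝ) →ₗ[ℝ] (Fin s → ℝ) := Matrix.mulVecLin (Matrix.of fun i => D i j)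
    obtain ⟨Q, c, hc, hQ⟩ := F.exists_projection_bound
    refine ⟨c, hc, fun y => hQ y (Subtype.ext ?_)⟩
    refine eq_zero_of_forall_sub_mul_eq_zero (hτ.comp Sum.inl_injective) (fun _ => hpos _)
      (by simpa using hs) (p (.inr j)) _ fun i => ?_
    have := sum_sub_mul_eq_zero_of_edgeDirection p (.inl i) (.inr j) _ (congrFun (Q y).2 i)
    rw [← neg_eq_zero, ← this, ← Finset.sum_neg_distrib]
    exact Finset.sum_congr rfl fun k _ => by rw [← neg_mul, neg_sub]; rfl
  choose cι hcι hι using hι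
  choose cκ hcκ hκ using hκ
  obtain ⟨c₁, hc₁, hle⟩ := exists_pos_forall_le (f := Sum.elim cι cκ)
    (by rintro (i | j); exacts [hcι i, hcκ j])
  have hs0 : 0 < s := by omega
  have ht0 : 0 < t := by omega
  have hs' : (0 : ℝ) < s := by exact_mod_cast hs0
  have ht' : (0 : ℝ) < t := by exact_mod_cast ht0
  -- With `a = n / (2s)` and `b = m / (2t)`, these three quantities are what `a * b * c₂ / (2n)` (or
  -- `/ (2m)`), `a * c₁ / 2` and `b * c₁ / 2` leave after a factor `n` or `m` is removed.
  obtain ⟨c, hc, hcle⟩ := exists_pos_forall_le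
    (f := ![c₂ / (8 * s * t), c₁ / (4 * s), c₁ / (4 * t)])
    (by intro i; fin_cases i <;> simp <;> positivity)
  have hcle1 : c ≤ c₂ / (8 * s * t) := hcle 0
  have hcle2 : c ≤ c₁ / (4 * s) := hcle 1
  have hcle3 : c ≤ c₁ / (4 * t) := hcle 2
  rw [le_div_iff₀ (by positivity)] at hcle1 hcle2 hcle3
  refine ⟨c, hc, fun n m hn hm => ?_⟩
  let f := residueMap n s hs0
  let g := residueMap m t ht0
  have hn0 : (0 : ℝ) < n := by exact_mod_cast hs0.trans_le hn
  have hm0 : (0 : ℝ) < m := by exact_mod_cast ht0.trans_le hm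
  have hfa := le_card_fiber_residueMap hs0 hn
  have hgb := le_card_fiber_residueMap ht0 hm
  have ha : 0 < (n : ℝ) / (2 * s) := by positivity
  have hb : 0 < (m : ℝ) / (2 * t) := by positivity
  have hminn : ((min n m : ℕ) : ℝ) ≤ n := by exact_mod_cast min_le_left n m
  have hminm : ((min n m : ℕ) : ℝ) ≤ m := by exact_mod_cast min_le_right n m
  refine le_trans ?_ (spectralGap_le_algebraicConnectivity _ (p ∘ Sum.map f g))
  rw [spectralGap]
  refine le_kthSmallestEigenvalue (isHermitian_stiffnessMatrix _ _) (P ∘ₗ clusterAverage f g d) hker ?_ fun x hx => ?_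
  -- The matrix is large enough that the eigenvalue is not the dummy value.
  · have h1 : (d + 1).choose 2 ≤ (d + 1) * d := by
      rw [Nat.choose_two_right]
      exact Nat.div_le_self _ _
    simp only [Fintype.card_prod, Fintype.card_sum, Fintype.card_fin]
    nlinarith
  refine le_trans ?_ (sum_le_dotProduct_stiffnessMatrix_mulVec _ _)
  set Z := clusterAverage f g d x
  have hxx : x ⬝ᵥ x = ∑ u, ∑ k, x (.inl u, k) ^ 2 + ∑ v, ∑ k, x (.inr v, k) ^ 2 := by
    simp [dotProduct, Fintype.sum_prod_type, pow_two]
  rw [hxx]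
  refine le_sum_sum_sq_of_cluster f g D ha.le hb.le hfa hgb (c₁ := c₁) (c₂ := c₂)
    (fun i y => (mul_le_mul_of_nonneg_right (hle (.inl i))
      (Finset.sum_nonneg fun _ _ => sq_nonneg _)).trans (hι i y))
    (fun j y => (mul_le_mul_of_nonneg_right (hle (.inr j))
      (Finset.sum_nonneg fun _ _ => sq_nonneg _)).trans (hκ j y))
    (fun u k => x (.inl u, k)) (fun v k => x (.inr v, k)) (fun i k => Z (.inl i, k))
    (fun j k => Z (.inr j, k))
    (fun i k => sum_sub_average_eq_zero (ha.trans_le (hfa i)) _)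
    (fun j k => sum_sub_average_eq_zero (hb.trans_le (hgb j)) _) ?_ (by positivity) ?_ ?_ ?_ ?_
  · have := hP Z hx
    rw [Fintype.sum_prod_type, Fintype.sum_sum_type, Fintype.sum_prod_type] at this
    exact this
  · rw [Fintype.card_fin, div_mul_div_comm, div_mul_eq_mul_div, le_div_iff₀ (by positivity)]
    calc c * ((min n m : ℕ) : ℝ) * (2 * n) * (2 * s * (2 * t))
        = (c * (8 * s * t)) * (n * ((min n m : ℕ) : ℝ)) := by ring
      _ ≤ c₂ * (n * m) := by gcongr
      _ = _ := by ring
  · rw [Fintype.card_fin, div_mul_div_comm, div_mul_eq_mul_div, le_div_iff₀ (by positivity)]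
    calc c * ((min n m : ℕ) : ℝ) * (2 * m) * (2 * s * (2 * t))
        = (c * (8 * s * t)) * (((min n m : ℕ) : ℝ) * m) := by ring
      _ ≤ c₂ * (n * m) := by gcongr
      _ = _ := by ring
  · rw [div_mul_eq_mul_div, le_div_iff₀ (by positivity)]
    calc c * ((min n m : ℕ) : ℝ) * 2 * (2 * s)
        = (c * (4 * s)) * ((min n m : ℕ) : ℝ) := by ring
      _ ≤ c₁ * n := by gcongr
      _ = _ := by ring
  · rw [div_mul_eq_mul_div, le_div_iff₀ (by positivity)]
    calc c * ((min n m : ℕ) : ℝ) * 2 * (2 * t)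
        = (c * (4 * t)) * ((min n m : ℕ) : ℝ) := by ring
      _ ≤ c₁ * m := by gcongr
      _ = _ := by ring

end SimpleGraph

theorem theorem1p4 (d : ℕ) (hd : 1 ≤ d) :
    ∃ c : ℝ, 0 < c ∧ ∀ n m : ℕ, d + 1 ≤ n → d + 1 ≤ m → (d + 2).choose 2 ≤ n + m →
      c * ((min n m : ℕ) : ℝ) ≤
        (completeBipartiteGraph (Fin n) (Fin m)).algebraicConnectivity d := by
  have hN : d + 1 ≤ (d + 2).choose 2 := by
    rw [Nat.choose_succ_left (d + 1) 2 (by norm_num), Nat.choose_one_right]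
    omega
  set N := (d + 2).choose 2
  have key : ∀ q : Fin (N + 1) × Fin (N + 1), ∃ c : ℝ, 0 < c ∧
      (d + 1 ≤ (q.1 : ℕ) → d + 1 ≤ (q.2 : ℕ) → N ≤ q.1 + q.2 → ∀ n m : ℕ, q.1 ≤ n → q.2 ≤ m →
        c * ((min n m : ℕ) : ℝ) ≤
          (completeBipartiteGraph (Fin n) (Fin m)).algebraicConnectivity d) := by
    intro q
    by_cases h : d + 1 ≤ (q.1 : ℕ) ∧ d + 1 ≤ (q.2 : ℕ) ∧ N ≤ q.1 + q.2
    · obtain ⟨c, hc, hq⟩ :=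
        SimpleGraph.exists_pos_forall_le_algebraicConnectivity hd h.1 h.2.1 h.2.2
      exact ⟨c, hc, fun _ _ _ => hq⟩
    · exact ⟨1, one_pos, fun h1 h2 h3 => absurd ⟨h1, h2, h3⟩ h⟩
  choose C hC hkey using key
  obtain ⟨c, hc, hcC⟩ := exists_pos_forall_le hC
  refine ⟨c, hc, fun n m hn hm hnm => ?_⟩
  -- Truncation at `N` preserves the hypotheses: `d + 1 ≤ N`, and one truncated side alone already
  -- gives `N ≤ s + t`.
  refine le_trans (mul_le_mul_of_nonneg_right (hcC (⟨min n N, by omega⟩, ⟨min m N, by omega⟩))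
    (Nat.cast_nonneg _)) (hkey _ ?_ ?_ ?_ n m ?_ ?_)
  all_goals dsimp only; omega
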